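/- Let $C \subset \mathbb{R}^p$ be a convex set containing the origin in its interior, let $\|X\|_C := \inf\{t > 0 : X \in tC\}$ be its Minkowski functional (gauge), and let $X \in \mathbb{R}^p$ satisfy $\|X\|_C \neq 0$ (when $C$ is bounded, this just means $X \neq 0$). Let $\partial\|X\|_C$ denote the subdifferential of the function $\|\cdot\|_C$ at $X$, let $\|\cdot\|_2$ be the Euclidean norm, and let $\mathbb{S}^{p-1}$ be the Euclidean unit sphere. Define - the Gaussian distance $\eta_C(X) := \inf_{\lambda \ge 0} \mathbb{E}_{g \sim \mathcal{N}(0, I_{p\times p})}\big[\mathrm{dist}(g, \lambda \cdot \partial\|X\|_C)\big]$, where $\mathrm{dist}(g,K) := \inf_{w \in K}\|w-g\|_2$; - the Gaussian width $\omega(S) := \mathbb{E}_{g \sim \mathcal{N}(0, I_{p\times p})}\big[\sup_{z \in S} g^T z\big]$ of a set $S \subseteq \mathbb{R}^p$; - the skewness $\kappa_C(X) := \|\Pi_{\partial\|X\|_C}(0)\|_2 \,/\, \|\Pi_{\mathrm{aff}(\partial\|X\|_C)}(0)\|_2$, where $\Pi_K$ is the Euclidean projection onto $K$ and $\mathrm{aff}$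 denotes the affine hull; - the tangent cone $T_C(X) := \mathrm{cone}\{Z - \bar X : Z \in \mathbb{R}^p,\ \|Z\|_C \le \|\bar X\|_C\}$, where $\bar X := X/\|X\|_C$. Then $$\eta_C(X) \;\le\; \omega\big(T_C(X) \cap \mathbb{S}^{p-1}\big) + 3\,\kappa_C(X) + 4.$$ -/

import Mathlib

open MeasureTheory ProbabilityTheory
open scoped Pointwise

noncomputable section

/-- The subdifferential `∂f(X)` of a function `f : ℝᵖ → ℝ` at the point `X`. -/
def subdifferential {p : ℕ} (f : EuclideanSpace ℝ (Fin p) → ℝ) (X : EuclideanSpace ℝ (Fin p)) :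
    Set (EuclideanSpace ℝ (Fin p)) :=
  {W | ∀ Y, f X + inner ℝ W (Y - X) ≤ f Y}

/-- The Gaussian distance
`η_C(X) = inf_{λ ≥ 0} E_{g ∼ N(0, I)} [dist (g, λ ∂‖X‖_C)]`, where `‖·‖_C` is the Minkowski
functional `gauge C` and `dist` is the Euclidean distance from a point to a set. -/
def gaussianDistance {p : ℕ} (C : Set (EuclideanSpace ℝ (Fin p)))
    (X : EuclideanSpace ℝ (Fin p)) : ℝ :=
  sInf ((fun l : ℝ => ∫ g, Metric.infDist g (l • subdifferential (gauge C) X)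
    ∂(stdGaussian (EuclideanSpace ℝ (Fin p)))) '' Set.Ici 0)

/-- The Gaussian width `ω(S) = E_{g ∼ N(0, I)} [sup_{z ∈ S} gᵀz]`. -/
def gaussianWidth {p : ℕ} (S : Set (EuclideanSpace ℝ (Fin p))) : ℝ :=
  ∫ g, sSup ((fun z => inner ℝ g z) '' S) ∂(stdGaussian (EuclideanSpace ℝ (Fin p)))

/-- The Euclidean projection `Π_K(x)`: the point of `K` nearest to `x`. It exists and is unique
when `K` is non-empty, closed and convex. -/
def euclideanProj {p : ℕ} (K : Set (EuclideanSpace ℝ (Fin p))) (x : EuclideanSpace ℝ (Fin p)) :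
    EuclideanSpace ℝ (Fin p) :=
  Classical.epsilon fun w => w ∈ K ∧ ∀ v ∈ K, ‖x - w‖ ≤ ‖x - v‖

/-- The skewness `κ_C(X) = ‖Π_{∂‖X‖_C}(0)‖ / ‖Π_{aff ∂‖X‖_C}(0)‖`. -/
def skewness {p : ℕ} (C : Set (EuclideanSpace ℝ (Fin p))) (X : EuclideanSpace ℝ (Fin p)) : ℝ :=
  ‖euclideanProj (subdifferential (gauge C) X) 0‖ /
    ‖euclideanProj
      (affineSpan ℝ (subdifferential (gauge C) X) : Set (EuclideanSpace ℝ (Fin p))) 0‖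

/-- The cone `cone {Z - X | ‖Z‖_C ≤ ‖X‖_C}`, to be used at points with `‖X‖_C = 1`. -/
def unitTangentCone {p : ℕ} (C : Set (EuclideanSpace ℝ (Fin p)))
    (X : EuclideanSpace ℝ (Fin p)) : Set (EuclideanSpace ℝ (Fin p)) :=
  (PointedCone.hull ℝ {D | ∃ Z, gauge C Z ≤ gauge C X ∧ D = Z - X} :
    PointedCone ℝ (EuclideanSpace ℝ (Fin p)))

/-- The tangent cone `T_C(X)` at a general point `X` with `‖X‖_C ≠ 0`: the tangent cone to the
unit ball of `‖·‖_C` at the normalized point `X / ‖X‖_C`. -/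
def tangentCone {p : ℕ} (C : Set (EuclideanSpace ℝ (Fin p)))
    (X : EuclideanSpace ℝ (Fin p)) : Set (EuclideanSpace ℝ (Fin p)) :=
  unitTangentCone C ((gauge C X)⁻¹ • X)

/-- The projection is well defined on non-empty closed sets. -/
theorem euclideanProj_spec {p : ℕ} {K : Set (EuclideanSpace ℝ (Fin p))} (hK : IsClosed K)
    (hne : K.Nonempty) (x : EuclideanSpace ℝ (Fin p)) :
    euclideanProj K x ∈ K ∧ ∀ v ∈ K, ‖x - euclideanProj K x‖ ≤ ‖x - v‖ := by
  refine Classical.epsilon_spec (p := fun w => w ∈ K ∧ ∀ v ∈ K, ‖x - w‖ ≤ ‖x - v‖) ?_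
  obtain ⟨w, hw, h⟩ := hK.exists_infDist_eq_dist hne x
  refine ⟨w, hw, fun v hv => ?_⟩
  rw [← dist_eq_norm, ← dist_eq_norm, ← h]
  exact Metric.infDist_le_dist_of_mem hv

/-- The expectation in the Gaussian distance is that of an integrable function. -/
theorem integrable_infDist_stdGaussian {p : ℕ} (K : Set (EuclideanSpace ℝ (Fin p))) :
    Integrable (fun g => Metric.infDist g K) (stdGaussian (EuclideanSpace ℝ (Fin p))) := by
  have h1 : Integrable (fun g : EuclideanSpace ℝ (Fin p) => ‖g‖ + Metric.infDist 0 K)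
      (stdGaussian (EuclideanSpace ℝ (Fin p))) :=
    (IsGaussian.integrable_id.norm).add (integrable_const _)
  refine h1.mono' (Metric.continuous_infDist_pt K).aestronglyMeasurable
    (Filter.Eventually.of_forall fun g => ?_)
  rw [Real.norm_of_nonneg Metric.infDist_nonneg]
  have := Metric.infDist_le_infDist_add_dist (s := K) (x := g) (y := 0)
  rw [dist_zero_right] at this
  linarith

/-- The expectation in the Gaussian width of a set of unit vectors is that of an integrable
function. -/
theorem integrable_sSup_inner_stdGaussian {p : ℕ} (S : Set (EuclideanSpace ℝ (Fin p)))
    (hS : S ⊆ Metric.sphere 0 1) :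
    Integrable (fun g => sSup ((fun z => (inner ℝ g z : ℝ)) '' S))
      (stdGaussian (EuclideanSpace ℝ (Fin p))) := by
  rcases S.eq_empty_or_nonempty with rfl | hne
  · simp
  have hz : ∀ z ∈ S, ‖z‖ = 1 := fun z hz => by simpa using hS hz
  have hle : ∀ (g : EuclideanSpace ℝ (Fin p)), ∀ z ∈ S, (inner ℝ g z : ℝ) ≤ ‖g‖ := fun g z h => by
    have := real_inner_le_norm g z
    rwa [hz z h, mul_one] at this
  have hbdd : ∀ g : EuclideanSpace ℝ (Fin p),
      BddAbove ((fun z => (inner ℝ g z : ℝ)) '' S) := fun g => by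
    refine ⟨‖g‖, ?_⟩
    rintro _ ⟨z, h, rfl⟩
    exact hle g z h
  have hlip : LipschitzWith 1 fun g : EuclideanSpace ℝ (Fin p) =>
      sSup ((fun z => (inner ℝ g z : ℝ)) '' S) := by
    refine LipschitzWith.of_le_add fun g g' => csSup_le (hne.image _) ?_
    rintro _ ⟨z, h, rfl⟩
    have h1 : (inner ℝ g' z : ℝ) ≤ sSup ((fun z => (inner ℝ g' z : ℝ)) '' S) :=
      le_csSup (hbdd g') ⟨z, h, rfl⟩
    have h2 := hle (g - g') z h
    rw [inner_sub_left, ← dist_eq_norm] at h2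
    dsimp only
    linarith
  refine (IsGaussian.integrable_id.norm).mono' hlip.continuous.aestronglyMeasurable
    (Filter.Eventually.of_forall fun g => ?_)
  have h0 : sSup ((fun z => (inner ℝ (0 : EuclideanSpace ℝ (Fin p)) z : ℝ)) '' S) = 0 := by
    simp [hne.image_const]
  have := hlip.dist_le_mul g 0
  rw [h0] at this
  simpa using this

end

/-! Let `K` be the subdifferential, `N` the polar of the tangent cone, `w₀` and `w₁` the projections
of 0 onto the affine hull of `K` and onto `K`, and κ = ‖w₁‖ / ‖w₀‖. Every point of `N` lies in some
`l • K` with `l ≥ 0` (`exists_smul_subdifferential_of_mem_polarCone`), and conic duality bounds E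
dist(g, N) by the width plus 1 (`integral_infDist_polarCone_le`). What remains is to replace the
scale, which depends on g, by a fixed one.

The projection of g onto `N` is `lam g • w` with `w ∈ K`. Pairing with `w₀` is constant on `K`, so
`lam` is a linear functional of the projection, hence 1/‖w₀‖-Lipschitz, and the Gaussian Poincaré
inequality bounds its deviation. Let `l` exceed the mean of `lam` by that bound. Where `lam g ≤ l`,
passing from `N` to `l • K` costs at most (l - lam g)‖w₁‖.

The excess `G` over this cost is (2 + κ)-Lipschitz and nonpositive on that event. A Cantelli
argument (`integral_le_of_nonpos_of_le_mean_add`) then bounds its mean by its own deviation bound,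
so the bad event needs no separate estimate. -/

/-! ### Gaussian preliminaries. -/

theorem pi_fin_absolutelyContinuous (n : ℕ) (μ ν : Measure ℝ) [SigmaFinite μ] [SigmaFinite ν]
    (h : μ ≪ ν) :
    Measure.pi (fun _ : Fin n => μ) ≪ Measure.pi (fun _ : Fin n => ν) := by
  induction n with
  | zero =>
    rw [Measure.pi_of_empty (fun _ : Fin 0 => μ), Measure.pi_of_empty (fun _ : Fin 0 => ν)]
  | succ n ih =>
    have h1 := (measurePreserving_piFinSuccAbove (fun _ : Fin (n + 1) => μ) 0).symm
    have h2 := (measurePreserving_piFinSuccAbove (fun _ : Fin (n + 1) => ν) 0).symm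
    rw [← h1.map_eq, ← h2.map_eq]
    exact (h.prod ih).map h1.measurable

/-- Transfers Rademacher's theorem from Lebesgue measure to the Gaussian. -/
theorem stdGaussian_absolutelyContinuous (p : ℕ) :
    stdGaussian (EuclideanSpace ℝ (Fin p)) ≪ volume := by
  rw [← map_pi_eq_stdGaussian, ← (PiLp.volume_preserving_toLp (Fin p)).map_eq]
  refine Measure.AbsolutelyContinuous.map ?_ (PiLp.volume_preserving_toLp (Fin p)).measurable
  exact pi_fin_absolutelyContinuous p _ _ (gaussianReal_absolutelyContinuous 0 one_ne_zero)

/-- A continuous function of at most linear growth is square integrable for a Gaussian measure. -/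
theorem memLp_two_of_linear_growth {F : Type*} [NormedAddCommGroup F] [NormedSpace ℝ F]
    [MeasurableSpace F] [BorelSpace F] [SecondCountableTopology F] [CompleteSpace F]
    (μ : Measure F) [IsGaussian μ] {h : F → ℝ} (hc : Continuous h) (a b : ℝ)
    (hb : ∀ x, |h x| ≤ a + b * ‖x‖) : MemLp h 2 μ := by
  have h1 : MemLp (fun x : F => a + b * ‖x‖) 2 μ :=
    (memLp_const a).add ((IsGaussian.memLp_two_id (μ := μ)).norm.const_mul b)
  exact h1.of_le hc.aestronglyMeasurable
    (Filter.Eventually.of_forall fun x => (hb x).trans (le_abs_self _))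

theorem LipschitzWith.memLp_two_gaussian {F : Type*} [NormedAddCommGroup F] [NormedSpace ℝ F]
    [MeasurableSpace F] [BorelSpace F] [SecondCountableTopology F] [CompleteSpace F]
    (μ : Measure F) [IsGaussian μ] {f : F → ℝ} {L : NNReal} (hf : LipschitzWith L f) :
    MemLp f 2 μ := by
  refine memLp_two_of_linear_growth μ hf.continuous |f 0| L fun x => ?_
  have := hf.dist_le_mul x 0
  rw [Real.dist_eq, dist_zero_right] at this
  have h2 := abs_sub_abs_le_abs_sub (f x) (f 0)
  linarith

theorem integral_quadratic_comp {Ω : Type*} [MeasurableSpace Ω] {μ : Measure Ω}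
    [IsProbabilityMeasure μ] {f : Ω → ℝ} (hm : MemLp f 2 μ) (a b c : ℝ) :
    ∫ x, (a + b * f x + c * f x ^ 2) ∂μ = a + b * ∫ x, f x ∂μ + c * ∫ x, f x ^ 2 ∂μ := by
  have hi : Integrable f μ := hm.integrable (by norm_num)
  have hab : Integrable (fun x => a + b * f x) μ := (integrable_const _).add (hi.const_mul _)
  rw [integral_add hab (hm.integrable_sq.const_mul _),
    integral_add (integrable_const _) (hi.const_mul _), integral_const_mul, integral_const_mul]
  simp

/-! ### Gaussian Poincaré inequality by rotation. -/

section
variable {p : ℕ}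
local notation "E" => EuclideanSpace ℝ (Fin p)
local notation "γ" => stdGaussian (EuclideanSpace ℝ (Fin p))

/-- Mean square increment of `f` when a standard Gaussian vector is rotated by the angle `θ`. -/
noncomputable def rotationIncrement (f : EuclideanSpace ℝ (Fin p) → ℝ) (θ : ℝ) : ℝ :=
  ∫ z, (f (Real.cos θ • z.1 + Real.sin θ • z.2) - f z.1) ^ 2 ∂((γ).prod γ)

theorem memLp_rotation_sub {f : E → ℝ} {L : NNReal} (hf : LipschitzWith L f) (θ φ : ℝ) :
    MemLp (fun z : E × E => f (Real.cos θ • z.1 + Real.sin θ • z.2)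
      - f (Real.cos φ • z.1 + Real.sin φ • z.2)) 2 ((γ).prod γ) := by
  have key : ∀ θ : ℝ, MemLp (fun z : E × E => f (Real.cos θ • z.1 + Real.sin θ • z.2)) 2
      ((γ).prod γ) := fun θ => by
    have h := hf.comp ((ContinuousLinearMap.fst ℝ E E).comp
      (ContinuousLinearMap.rotation θ)).lipschitz
    exact h.memLp_two_gaussian _
  exact (key θ).sub (key φ)

/-- Rotation invariance gives the steps from 0 to θ and from θ to 2θ the same mean square; then (a +
b)² ≤ 2a² + 2b². -/
theorem rotationIncrement_two_mul_le {f : E → ℝ} {L : NNReal} (hf : LipschitzWith L f) (θ : ℝ) :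
    rotationIncrement f (2 * θ) ≤ 4 * rotationIncrement f θ := by
  have hrot : ((γ).prod γ).map (ContinuousLinearMap.rotation θ) = (γ).prod γ :=
    IsGaussian.map_rotation_eq_self (by simp) θ
  have hA : rotationIncrement f θ = ∫ z : E × E, (f (Real.cos (2 * θ) • z.1 + Real.sin (2 * θ) • z.2)
      - f (Real.cos θ • z.1 + Real.sin θ • z.2)) ^ 2 ∂((γ).prod γ) := by
    rw [rotationIncrement]
    conv_lhs => rw [← hrot]
    rw [integral_map (by fun_prop)]
    · refine integral_congr_ae (Filter.Eventually.of_forall fun z => ?_)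
      simp only [ContinuousLinearMap.rotation_apply]
      congr 3
      rw [Real.cos_two_mul, Real.sin_two_mul, Real.cos_sq']
      have := Real.sin_sq_add_cos_sq θ
      have h1 : 2 * (1 - Real.sin θ ^ 2) - 1 = Real.cos θ ^ 2 - Real.sin θ ^ 2 := by linarith
      rw [h1]
      module
    · have := hf.continuous
      exact Continuous.aestronglyMeasurable (by fun_prop)
  have i1 := (memLp_rotation_sub hf (2 * θ) θ).integrable_sq
  have i2 := (memLp_rotation_sub hf θ 0).integrable_sq
  simp only [Real.cos_zero, Real.sin_zero, one_smul, zero_smul, add_zero] at i2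
  have : rotationIncrement f (2 * θ) ≤ 2 * (rotationIncrement f θ + rotationIncrement f θ) := by
    conv_rhs => enter [2, 1]; rw [hA]
    rw [rotationIncrement, rotationIncrement, ← integral_add i1 i2, ← integral_const_mul]
    refine integral_mono_of_nonneg (Filter.Eventually.of_forall fun z => sq_nonneg _)
      ((i1.add i2).const_mul 2) (Filter.Eventually.of_forall fun z => ?_)
    dsimp only
    nlinarith [sq_nonneg ((f (Real.cos (2 * θ) • z.1 + Real.sin (2 * θ) • z.2)
      - f (Real.cos θ • z.1 + Real.sin θ • z.2)) -
      (f (Real.cos θ • z.1 + Real.sin θ • z.2) - f z.1))]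
  linarith

theorem rotationIncrement_pow_two_mul_le {f : E → ℝ} {L : NNReal} (hf : LipschitzWith L f) (θ : ℝ)
    (n : ℕ) : rotationIncrement f (2 ^ n * θ) ≤ 4 ^ n * rotationIncrement f θ := by
  induction n with
  | zero => simp
  | succ n ih =>
    have := rotationIncrement_two_mul_le hf (2 ^ n * θ)
    rw [pow_succ', pow_succ', mul_assoc, mul_assoc]
    linarith

theorem integral_sq_strongDual_stdGaussian (A : StrongDual ℝ E) :
    ∫ x, (A x) ^ 2 ∂γ = ‖A‖ ^ 2 := by
  rw [← variance_dual_stdGaussian A, variance_of_integral_eq_zero (by fun_prop) (by simp)]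

theorem hasDerivAt_rotation {f : E → ℝ} {x y : E} (hf : DifferentiableAt ℝ f x) :
    HasDerivAt (fun θ : ℝ => f (Real.cos θ • x + Real.sin θ • y)) (fderiv ℝ f x y) 0 := by
  have h1 : HasDerivAt (fun θ : ℝ => Real.cos θ • x + Real.sin θ • y) y 0 := by
    have := ((Real.hasDerivAt_cos 0).smul_const x).fun_add ((Real.hasDerivAt_sin 0).smul_const y)
    simpa using this
  have h2 : HasFDerivAt f (fderiv ℝ f x) ((fun θ : ℝ => Real.cos θ • x + Real.sin θ • y) 0) := by
    simpa using hf.hasFDerivAt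
  exact h2.comp_hasDerivAt 0 h1

theorem abs_rotation_sub_le {f : E → ℝ} {L : NNReal} (hf : LipschitzWith L f) (θ : ℝ) (x y : E) :
    |f (Real.cos θ • x + Real.sin θ • y) - f x| ≤ L * |θ| * (‖x‖ + ‖y‖) := by
  have h := hf.dist_le_mul (Real.cos θ • x + Real.sin θ • y) x
  rw [Real.dist_eq, dist_eq_norm] at h
  have h1 : Real.cos θ • x + Real.sin θ • y - x = (Real.cos θ - 1) • x + Real.sin θ • y := by
    module
  have hc : |Real.cos θ - 1| ≤ |θ| := by
    have := Real.abs_cos_sub_cos_le θ 0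
    simpa using this
  have hs : |Real.sin θ| ≤ |θ| := Real.abs_sin_le_abs
  have h2 : ‖(Real.cos θ - 1) • x + Real.sin θ • y‖ ≤ |θ| * (‖x‖ + ‖y‖) := by
    refine (norm_add_le _ _).trans ?_
    rw [norm_smul, norm_smul, Real.norm_eq_abs, Real.norm_eq_abs, mul_add]
    gcongr
  rw [h1] at h
  refine h.trans ?_
  rw [mul_assoc]
  gcongr

/-- Rademacher gives pointwise convergence of the difference quotients almost everywhere; the
Lipschitz bound supplies a square-integrable majorant. -/
theorem tendsto_rotationIncrement_div_sq {f : E → ℝ} {L : NNReal} (hf : LipschitzWith L f)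
    {u : ℕ → ℝ} (hu : Filter.Tendsto u Filter.atTop (nhds 0)) (hu0 : ∀ n, u n ≠ 0) :
    Filter.Tendsto (fun n => rotationIncrement f (u n) / u n ^ 2) Filter.atTop
      (nhds (∫ z, (fderiv ℝ f z.1 z.2) ^ 2 ∂((γ).prod γ))) := by
  have hcont := hf.continuous
  have hint : Integrable (fun z : E × E => ((L : ℝ) * (‖z.1‖ + ‖z.2‖)) ^ 2) ((γ).prod γ) := by
    have : MemLp (fun z : E × E => ((L : ℝ) * (‖z.1‖ + ‖z.2‖))) 2 ((γ).prod γ) := by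
      refine memLp_two_of_linear_growth _ (by fun_prop) 0 (L * 2) fun z => ?_
      rw [abs_of_nonneg (by positivity), zero_add, mul_assoc]
      gcongr
      have := norm_fst_le z
      have := norm_snd_le z
      linarith
    exact this.integrable_sq
  have hdiff : ∀ᵐ z ∂((γ).prod γ), DifferentiableAt ℝ f z.1 := by
    have h1 : ∀ᵐ x ∂γ, DifferentiableAt ℝ f x :=
      (stdGaussian_absolutelyContinuous p).ae_le hf.ae_differentiableAt
    exact Measure.quasiMeasurePreserving_fst.ae h1
  simp_rw [rotationIncrement, ← integral_div]
  refine tendsto_integral_of_dominated_convergence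
    (fun z : E × E => ((L : ℝ) * (‖z.1‖ + ‖z.2‖)) ^ 2) (fun n => ?_) hint (fun n => ?_) ?_
  · exact Continuous.aestronglyMeasurable (by fun_prop)
  · refine Filter.Eventually.of_forall fun z => ?_
    have h := abs_rotation_sub_le hf (u n) z.1 z.2
    have hpos : 0 < |u n| := abs_pos.2 (hu0 n)
    rw [← div_pow, norm_pow, Real.norm_eq_abs, abs_div]
    gcongr
    rw [div_le_iff₀ hpos]
    linarith
  · filter_upwards [hdiff] with z hz
    have h1 := (hasDerivAt_rotation (y := z.2) hz).tendsto_slope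
    have h2 : Filter.Tendsto u Filter.atTop (nhdsWithin 0 {0}ᶜ) :=
      tendsto_nhdsWithin_iff.2 ⟨hu, Filter.Eventually.of_forall hu0⟩
    have h3 := (h1.comp h2).pow 2
    refine h3.congr fun n => ?_
    simp [slope_def_field, div_pow]

/-- Gaussian Poincaré inequality for Lipschitz functions, with the Maurey-Pisier constant. -/
theorem LipschitzWith.integral_sq_sub_integral_stdGaussian_le {f : E → ℝ} {L : NNReal}
    (hf : LipschitzWith L f) :
    ∫ x, (f x - ∫ y, f y ∂γ) ^ 2 ∂γ ≤ Real.pi ^ 2 / 8 * (L : ℝ) ^ 2 := by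
  have hm : MemLp f 2 γ := hf.memLp_two_gaussian _
  have hi : Integrable f γ := hm.integrable (by norm_num)
  have hs : Integrable (fun x => f x ^ 2) γ := hm.integrable_sq
  have hgrad : ∫ z, (fderiv ℝ f z.1 z.2) ^ 2 ∂((γ).prod γ) ≤ (L : ℝ) ^ 2 := by
    -- Integrability need not be proved: otherwise the integral is 0 by convention.
    by_cases hI : Integrable (fun z : E × E => (fderiv ℝ f z.1 z.2) ^ 2) ((γ).prod γ)
    · rw [integral_prod _ hI]
      simp_rw [integral_sq_strongDual_stdGaussian]
      have : ∫ _ : E, (L : ℝ) ^ 2 ∂γ = (L : ℝ) ^ 2 := by simp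
      rw [← this]
      refine integral_mono_of_nonneg (Filter.Eventually.of_forall fun z => sq_nonneg _)
        (integrable_const _) (Filter.Eventually.of_forall fun z => ?_)
      have := norm_fderiv_le_of_lipschitz ℝ hf (x₀ := z)
      dsimp only
      gcongr
    · rw [integral_undef hI]; positivity
  -- After n doublings these angles reach π/2, where the rotated vector is an independent copy.
  have hlim := tendsto_rotationIncrement_div_sq hf (u := fun n : ℕ => Real.pi / 2 / 2 ^ n)
    (by
      have := (tendsto_pow_atTop_nhds_zero_of_lt_one (r := (1 / 2 : ℝ)) (by norm_num)
        (by norm_num)).const_mul (Real.pi / 2)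
      simpa [div_eq_mul_inv] using this)
    (fun n => by positivity)
  have hbound : rotationIncrement f (Real.pi / 2) ≤ (Real.pi / 2) ^ 2 *
      ∫ z, (fderiv ℝ f z.1 z.2) ^ 2 ∂((γ).prod γ) := by
    refine ge_of_tendsto (hlim.const_mul ((Real.pi / 2) ^ 2))
      (Filter.Eventually.of_forall fun n => ?_)
    have h := rotationIncrement_pow_two_mul_le hf (Real.pi / 2 / 2 ^ n) n
    rw [mul_div_cancel₀ _ (by positivity)] at h
    refine h.trans (le_of_eq ?_)
    have : (4 : ℝ) ^ n = (2 ^ n) ^ 2 := by rw [← pow_mul, mul_comm, pow_mul]; norm_num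
    rw [this]
    field_simp
  have hV : rotationIncrement f (Real.pi / 2) = 2 * ∫ x, (f x - ∫ y, f y ∂γ) ^ 2 ∂γ := by
    have h1 : rotationIncrement f (Real.pi / 2) = ∫ z, (f z.2 - f z.1) ^ 2 ∂((γ).prod γ) := by
      simp [rotationIncrement]
    have hI := (memLp_rotation_sub hf (Real.pi / 2) 0).integrable_sq
    simp only [Real.cos_zero, Real.sin_zero, one_smul, zero_smul, add_zero, Real.cos_pi_div_two,
      Real.sin_pi_div_two, zero_add] at hI
    have h2 : ∀ x : E, ∫ y, (f y - f x) ^ 2 ∂γ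
        = f x ^ 2 + (-2 * f x) * ∫ y, f y ∂γ + 1 * ∫ y, f y ^ 2 ∂γ := fun x => by
      rw [← integral_quadratic_comp hm]
      exact integral_congr_ae (Filter.Eventually.of_forall fun y => by dsimp only; ring)
    have h3 : ∫ x, (f x - ∫ y, f y ∂γ) ^ 2 ∂γ
        = ∫ y, f y ^ 2 ∂γ - (∫ y, f y ∂γ) ^ 2 := by
      have h := integral_quadratic_comp hm ((∫ y, f y ∂γ) ^ 2) (-2 * ∫ y, f y ∂γ) 1
      rw [show ∫ y, f y ^ 2 ∂γ - (∫ y, f y ∂γ) ^ 2 = (∫ y, f y ∂γ) ^ 2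
        + (-2 * ∫ y, f y ∂γ) * ∫ y, f y ∂γ + 1 * ∫ y, f y ^ 2 ∂γ by ring, ← h]
      exact integral_congr_ae (Filter.Eventually.of_forall fun y => by dsimp only; ring)
    rw [h1, integral_prod _ hI, h3]
    simp_rw [h2]
    have h := integral_quadratic_comp hm (∫ y, f y ^ 2 ∂γ) (-2 * ∫ y, f y ∂γ) 1
    rw [show 2 * (∫ y, f y ^ 2 ∂γ - (∫ y, f y ∂γ) ^ 2) = ∫ y, f y ^ 2 ∂γ
        + (-2 * ∫ y, f y ∂γ) * ∫ y, f y ∂γ + 1 * ∫ y, f y ^ 2 ∂γ by ring, ← h]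
    exact integral_congr_ae (Filter.Eventually.of_forall fun y => by dsimp only; ring)
  rw [hV] at hbound
  have hpi : 0 ≤ (Real.pi / 2) ^ 2 := by positivity
  nlinarith [mul_le_mul_of_nonneg_left hgrad hpi]

theorem LipschitzWith.integral_sq_sub_integral_stdGaussian_le' {f : E → ℝ} {L : NNReal}
    (hf : LipschitzWith L f) :
    ∫ x, (f x - ∫ y, f y ∂γ) ^ 2 ∂γ ≤ (3 / 2 * (L : ℝ)) ^ 2 := by
  refine hf.integral_sq_sub_integral_stdGaussian_le.trans ?_
  rw [mul_pow]
  gcongr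
  -- π < 4 gives π²/8 < 2 < (3/2)².
  nlinarith [Real.pi_lt_four, Real.pi_pos]

end

/-! ### A one-sided Chebyshev argument. -/

/-- If `G ≤ 0` wherever `f` is at most its mean plus its standard deviation bound `s`, then the
mean of `G` is at most its standard deviation bound `σ`. -/
theorem integral_le_of_nonpos_of_le_mean_add {Ω : Type*} [MeasurableSpace Ω] {μ : Measure Ω}
    [IsProbabilityMeasure μ] {f G : Ω → ℝ} (hf : MemLp f 2 μ) (hG : MemLp G 2 μ) {s σ : ℝ}
    (hs : 0 < s) (hσ : 0 < σ) (hfs : ∫ x, (f x - ∫ y, f y ∂μ) ^ 2 ∂μ ≤ s ^ 2)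
    (hGσ : ∫ x, (G x - ∫ y, G y ∂μ) ^ 2 ∂μ ≤ σ ^ 2)
    (h : ∀ x, f x ≤ ∫ y, f y ∂μ + s → G x ≤ 0) : ∫ y, G y ∂μ ≤ σ := by
  have key : ∀ {k : Ω → ℝ}, MemLp k 2 μ → ∀ c : ℝ,
      MemLp (fun x => k x - ∫ y, k y ∂μ + c) 2 μ ∧
      ∫ x, (k x - ∫ y, k y ∂μ + c) ^ 2 ∂μ = ∫ x, (k x - ∫ y, k y ∂μ) ^ 2 ∂μ + c ^ 2 := by
    intro k hk c
    have h1 : MemLp (fun x => k x - ∫ y, k y ∂μ) 2 μ := hk.sub (memLp_const _)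
    refine ⟨h1.add (memLp_const c), ?_⟩
    have h2 := integral_quadratic_comp h1 (c ^ 2) (2 * c) 1
    have h3 : ∫ x, (k x - ∫ y, k y ∂μ) ∂μ = 0 := by
      rw [integral_sub (hk.integrable (by norm_num)) (integrable_const _)]
      simp
    rw [h3] at h2
    rw [show ∫ x, (k x - ∫ y, k y ∂μ) ^ 2 ∂μ + c ^ 2
      = c ^ 2 + 2 * c * 0 + 1 * ∫ x, (k x - ∫ y, k y ∂μ) ^ 2 ∂μ by ring, ← h2]
    exact integral_congr_ae (Filter.Eventually.of_forall fun y => by dsimp only; ring)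
  by_contra! hlt
  obtain ⟨hfm, hfe⟩ := key hf s
  obtain ⟨hGm, hGe⟩ := key hG (-σ)
  set m := ∫ y, f y ∂μ
  set a := ∫ y, G y ∂μ
  have haσ : 0 < a + σ := by linarith
  -- The shifts by s and -σ are Cantelli's. The first term has mean at most 2s²/(4s²) = 1/2; the
  -- second has mean at most 2σ²/(a + σ)² < 1/2, since a > σ. Integrating the pointwise bound gives
  -- 1 < 1.
  have hpt : ∀ x, 1 ≤ (f x - m + s) ^ 2 / (4 * s ^ 2) + (G x - a + -σ) ^ 2 / (a + σ) ^ 2 := by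
    intro x
    by_cases hx : f x ≤ m + s
    · have h1 : 1 ≤ (G x - a + -σ) ^ 2 / (a + σ) ^ 2 := by
        rw [one_le_div (by positivity)]
        nlinarith [h x hx]
      have : 0 ≤ (f x - m + s) ^ 2 / (4 * s ^ 2) := by positivity
      linarith
    · push Not at hx
      have h1 : 1 ≤ (f x - m + s) ^ 2 / (4 * s ^ 2) := by
        rw [one_le_div (by positivity)]
        nlinarith
      have : 0 ≤ (G x - a + -σ) ^ 2 / (a + σ) ^ 2 := by positivity
      linarith
  have hint : ∫ _ : Ω, (1 : ℝ) ∂μ ≤ ∫ x, ((f x - m + s) ^ 2 / (4 * s ^ 2)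
      + (G x - a + -σ) ^ 2 / (a + σ) ^ 2) ∂μ :=
    integral_mono (integrable_const _)
      ((hfm.integrable_sq.div_const _).add (hGm.integrable_sq.div_const _)) hpt
  rw [integral_add (hfm.integrable_sq.div_const _) (hGm.integrable_sq.div_const _), integral_div,
    integral_div, hfe, hGe] at hint
  have h1 : (∫ x, (f x - m) ^ 2 ∂μ + s ^ 2) / (4 * s ^ 2) ≤ 1 / 2 := by
    rw [div_le_iff₀ (by positivity)]; linarith
  have h2 : (∫ x, (G x - a) ^ 2 ∂μ + (-σ) ^ 2) / (a + σ) ^ 2 < 1 / 2 := by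
    rw [div_lt_iff₀ (by positivity)]; nlinarith
  simp at hint
  simp at h2
  linarith

/-! ### Projections onto convex cones and polarity. -/

section cone
variable {F : Type*} [NormedAddCommGroup F] [InnerProductSpace ℝ F]

/-- Moreau's characterization of the projection onto a closed convex cone. -/
theorem exists_cone_projection [CompleteSpace F] {N : Set F} (hcl : IsClosed N)
    (hconv : Convex ℝ N) (h0 : (0 : F) ∈ N) (hsmul : ∀ c : ℝ, 0 ≤ c → ∀ x ∈ N, c • x ∈ N) (g : F) :
    ∃ v ∈ N, (∀ y ∈ N, inner ℝ (g - v) y ≤ 0) ∧ inner ℝ (g - v) v = 0 := by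
  obtain ⟨v, hv, hmin⟩ := exists_norm_eq_iInf_of_complete_convex ⟨0, h0⟩ hcl.isComplete hconv g
  have h := (norm_eq_iInf_iff_real_inner_le_zero hconv hv).1 hmin
  -- Testing against 0 and 2v, both in the cone, gives the two signs of ⟨g - v, v⟩.
  have h1 := h 0 h0
  have h2 := h ((2 : ℝ) • v) (hsmul 2 (by norm_num) v hv)
  rw [inner_sub_right] at h1 h2
  rw [inner_zero_right] at h1
  rw [real_inner_smul_right] at h2
  have h3 : inner ℝ (g - v) v = (0 : ℝ) := by linarith
  refine ⟨v, hv, fun y hy => ?_, h3⟩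
  have := h y hy
  rw [inner_sub_right] at this
  linarith

/-- The variational inequalities give ‖v - v'‖² ≤ ⟨g - g', v - v'⟩; Cauchy–Schwarz finishes. -/
theorem norm_cone_projection_sub_le {g g' v v' : F} (h1 : inner ℝ (g - v) v' ≤ 0)
    (h2 : inner ℝ (g - v) v = 0) (h1' : inner ℝ (g' - v') v ≤ 0)
    (h2' : inner ℝ (g' - v') v' = 0) : ‖v - v'‖ ≤ ‖g - g'‖ := by
  have h3 : ‖v - v'‖ ^ 2 ≤ inner ℝ (g - g') (v - v') := by
    rw [← real_inner_self_eq_norm_sq]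
    simp only [inner_sub_left, inner_sub_right] at *
    linarith
  have h4 := real_inner_le_norm (g - g') (v - v')
  by_contra! hlt
  have : 0 < ‖v - v'‖ := (norm_nonneg _).trans_lt hlt
  nlinarith

theorem infDist_eq_norm_sub_cone_projection {N : Set F} {g v : F} (hv : v ∈ N)
    (h1 : ∀ y ∈ N, inner ℝ (g - v) y ≤ 0) (h2 : inner ℝ (g - v) v = 0) :
    Metric.infDist g N = ‖g - v‖ := by
  refine le_antisymm ((Metric.infDist_le_dist_of_mem hv).trans_eq (dist_eq_norm _ _)) ?_
  refine (Metric.le_infDist ⟨v, hv⟩).2 fun y hy => ?_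
  rw [dist_eq_norm]
  have h3 : ‖g - v‖ ^ 2 ≤ inner ℝ (g - v) (g - y) := by
    rw [← real_inner_self_eq_norm_sq, show g - y = (g - v) + (v - y) by abel,
      inner_add_right, inner_sub_right _ v y, h2]
    linarith [h1 y hy]
  have h4 := real_inner_le_norm (g - v) (g - y)
  by_contra! hlt
  have : 0 < ‖g - v‖ := (norm_nonneg _).trans_lt hlt
  nlinarith

/-- The polar cone of a set. -/
def polarCone (T : Set F) : Set F := {v | ∀ z ∈ T, inner ℝ v z ≤ 0}

theorem isClosed_polarCone (T : Set F) : IsClosed (polarCone T) := by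
  have : polarCone T = ⋂ z ∈ T, {v | inner ℝ v z ≤ 0} := by ext; simp [polarCone]
  rw [this]
  exact isClosed_biInter fun z _ => isClosed_le (by fun_prop) continuous_const

theorem convex_polarCone (T : Set F) : Convex ℝ (polarCone T) := by
  intro x hx y hy a b ha hb _ z hz
  rw [inner_add_left, real_inner_smul_left, real_inner_smul_left]
  nlinarith [mul_nonneg ha (neg_nonneg.2 (hx z hz)), mul_nonneg hb (neg_nonneg.2 (hy z hz))]

theorem zero_mem_polarCone (T : Set F) : (0 : F) ∈ polarCone T := fun z _ => by simp

theorem smul_mem_polarCone {T : Set F} {c : ℝ} (hc : 0 ≤ c) {x : F} (hx : x ∈ polarCone T) :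
    c • x ∈ polarCone T := fun z hz => by
  rw [real_inner_smul_left]
  nlinarith [mul_nonneg hc (neg_nonneg.2 (hx z hz))]

/-- Half of the bipolar theorem: the residual of projecting r onto the closure is polar to `T`, and
testing r against it forces it to vanish. -/
theorem mem_closure_of_forall_polarCone [CompleteSpace F] (T : PointedCone ℝ F) {r : F}
    (hr : ∀ y ∈ polarCone (T : Set F), inner ℝ r y ≤ 0) : r ∈ closure (T : Set F) := by
  obtain ⟨a, ha, h1, h2⟩ := exists_cone_projection (N := closure (T : Set F)) isClosed_closure
    (PointedCone.convex T).closure (subset_closure T.zero_mem)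
    (fun c hc x hx => map_mem_closure (continuous_const_smul c) hx
      fun y hy => PointedCone.smul_mem T hc hy) r
  have h3 := hr (r - a) fun z hz => h1 z (subset_closure hz)
  have h4 : ‖r - a‖ ^ 2 ≤ 0 := by
    rw [← real_inner_self_eq_norm_sq]
    have : inner ℝ r (r - a) = inner ℝ (r - a) (r - a) + inner ℝ (r - a) a := by
      rw [real_inner_comm, ← inner_add_right]; simp
    linarith
  have h5 : r - a = 0 := by
    have := norm_nonneg (r - a)
    exact norm_eq_zero.1 (by nlinarith)
  rw [sub_eq_zero] at h5
  rwa [h5]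

theorem bddAbove_inner_image {S : Set F} (hS : S ⊆ Metric.sphere 0 1) (g : F) :
    BddAbove ((fun z => (inner ℝ g z : ℝ)) '' S) := by
  refine ⟨‖g‖, ?_⟩
  rintro _ ⟨z, h, rfl⟩
  have hz : ‖z‖ = 1 := by simpa using hS h
  simpa [hz] using real_inner_le_norm g z

/-- The distance to the polar of a convex cone is at most the positive part of the support function
of the spherical part of the cone. -/
theorem infDist_polarCone_le [CompleteSpace F] (T : PointedCone ℝ F) (g : F) :
    Metric.infDist g (polarCone (T : Set F)) ≤
      max 0 (sSup ((fun z => (inner ℝ g z : ℝ)) '' ((T : Set F) ∩ Metric.sphere 0 1))) := by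
  obtain ⟨v, hv, h1, h2⟩ := exists_cone_projection (isClosed_polarCone (T : Set F))
    (convex_polarCone _) (zero_mem_polarCone _) (fun c hc x hx => smul_mem_polarCone hc hx) g
  rw [infDist_eq_norm_sub_cone_projection hv h1 h2]
  have hr := mem_closure_of_forall_polarCone T h1
  set s := sSup ((fun z => (inner ℝ g z : ℝ)) '' ((T : Set F) ∩ Metric.sphere 0 1)) with hs
  have hT : ∀ t ∈ (T : Set F), inner ℝ g t ≤ s * ‖t‖ := by
    intro t ht
    rcases eq_or_ne t 0 with rfl | h0
    · simp
    have hpos : 0 < ‖t‖ := norm_pos_iff.2 h0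
    have : inner ℝ g (‖t‖⁻¹ • t) ≤ s := by
      refine le_csSup (bddAbove_inner_image Set.inter_subset_right g) ⟨‖t‖⁻¹ • t, ⟨?_, ?_⟩, rfl⟩
      · exact PointedCone.smul_mem T (by positivity : 0 ≤ ‖t‖⁻¹) ht
      · simp [norm_smul, h0]
    rwa [real_inner_smul_right, inv_mul_le_iff₀ hpos, mul_comm] at this
  have hcl : IsClosed {t : F | inner ℝ g t ≤ s * ‖t‖} :=
    isClosed_le (by fun_prop) (by fun_prop)
  have h3 : inner ℝ g (g - v) ≤ s * ‖g - v‖ := closure_minimal hT hcl hr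
  have h4 : inner ℝ g (g - v) = ‖g - v‖ ^ 2 := by
    rw [← real_inner_self_eq_norm_sq, inner_sub_left g v (g - v), real_inner_comm _ v, h2, sub_zero]
  -- If the residual is 0, then g is in the polar cone and the supremum may be negative; hence the
  -- positive part.
  rcases (norm_nonneg (g - v)).eq_or_lt with h5 | h5
  · rw [← h5]; exact le_max_left _ _
  · refine le_max_of_le_right ?_
    nlinarith

end cone

/-! ### Subdifferential of the gauge and normal cone. -/

section subdifferential
variable {p : ℕ} {C : Set (EuclideanSpace ℝ (Fin p))} {X : EuclideanSpace ℝ (Fin p)}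

theorem gauge_smul_of_nonneg' (C : Set (EuclideanSpace ℝ (Fin p))) {a : ℝ} (ha : 0 ≤ a)
    (x : EuclideanSpace ℝ (Fin p)) : gauge C (a • x) = a * gauge C x := by
  rw [gauge_smul_of_nonneg ha, smul_eq_mul]

/-- By positive homogeneity, testing Y = 0 and Y = 2X forces equality at X. -/
theorem mem_subdifferential_gauge {W : EuclideanSpace ℝ (Fin p)} :
    W ∈ subdifferential (gauge C) X ↔
      (∀ Y, inner ℝ W Y ≤ gauge C Y) ∧ inner ℝ W X = gauge C X := by
  simp only [subdifferential, Set.mem_ofPred_eq, inner_sub_right]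
  constructor
  · intro h
    have h1 := h 0
    have h2 := h ((2 : ℝ) • X)
    rw [gauge_smul_of_nonneg' C (by norm_num), real_inner_smul_right] at h2
    rw [gauge_zero, inner_zero_right] at h1
    have h3 : inner ℝ W X = gauge C X := by linarith
    exact ⟨fun Y => by linarith [h Y], h3⟩
  · rintro ⟨h1, h2⟩ Y
    linarith [h1 Y]

theorem isClosed_subdifferential (f : EuclideanSpace ℝ (Fin p) → ℝ) (X) :
    IsClosed (subdifferential f X) := by
  have : subdifferential f X = ⋂ Y, {W | f X + inner ℝ W (Y - X) ≤ f Y} := by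
    ext; simp [subdifferential]
  rw [this]
  exact isClosed_iInter fun Y => isClosed_le (by fun_prop) continuous_const

theorem convex_subdifferential (f : EuclideanSpace ℝ (Fin p) → ℝ) (X) :
    Convex ℝ (subdifferential f X) := by
  intro x hx y hy a b ha hb hab Y
  rw [inner_add_left, real_inner_smul_left, real_inner_smul_left]
  have h1 := mul_le_mul_of_nonneg_left (hx Y) ha
  have h2 := mul_le_mul_of_nonneg_left (hy Y) hb
  obtain rfl : b = 1 - a := by linarith
  linarith

/-- Hahn–Banach: extend cX ↦ c‖X‖_C from the line through X, dominated by the gauge. -/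
theorem subdifferential_gauge_nonempty (hC : Convex ℝ C)
    (h0 : (0 : EuclideanSpace ℝ (Fin p)) ∈ interior C) (hX : X ≠ 0) :
    (subdifferential (gauge C) X).Nonempty := by
  have habs : Absorbent ℝ C := absorbent_nhds_zero (mem_interior_iff_mem_nhds.1 h0)
  obtain ⟨f, hf1, hf2⟩ := exists_extension_of_le_sublinear
    (LinearPMap.mkSpanSingleton X (gauge C X) hX) (gauge C)
    (fun c hc x => gauge_smul_of_nonneg' C hc.le x) (gauge_add_le hC habs) (by
      rintro ⟨x, hx⟩
      obtain ⟨c, rfl⟩ := Submodule.mem_span_singleton.1 hx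
      refine (LinearPMap.mkSpanSingleton'_apply X (gauge C X) _ c hx).trans_le ?_
      simp only [RingHom.id_apply, smul_eq_mul]
      rcases le_total 0 c with hc | hc
      · exact (gauge_smul_of_nonneg' C hc X).ge
      · exact (mul_nonpos_of_nonpos_of_nonneg hc (gauge_nonneg _)).trans (gauge_nonneg _))
  refine ⟨(InnerProductSpace.toDual ℝ _).symm (LinearMap.toContinuousLinearMap f), ?_⟩
  rw [mem_subdifferential_gauge]
  simp only [InnerProductSpace.toDual_symm_apply, LinearMap.coe_toContinuousLinearMap']
  refine ⟨hf2, ?_⟩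
  have := hf1 ⟨X, Submodule.mem_span_singleton_self X⟩
  rw [this]
  exact LinearPMap.mkSpanSingleton_apply ℝ ℝ hX _

/-- The normal cone at `X` is generated by the subdifferential of the gauge. -/
theorem exists_smul_subdifferential_of_mem_polarCone (hX : gauge C X ≠ 0)
    (hne : (subdifferential (gauge C) X).Nonempty) {v : EuclideanSpace ℝ (Fin p)}
    (hv : v ∈ polarCone (tangentCone C X)) :
    ∃ l : ℝ, 0 ≤ l ∧ ∃ w ∈ subdifferential (gauge C) X, v = l • w := by
  have hpos : 0 < gauge C X := lt_of_le_of_ne (gauge_nonneg _) hX.symm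
  set x := (gauge C X)⁻¹ • X with hx
  have hgx : gauge C x = 1 := by
    rw [hx, gauge_smul_of_nonneg' C (by positivity), inv_mul_cancel₀ hX]
  have h1 : ∀ Z, gauge C Z ≤ 1 → inner ℝ v Z ≤ inner ℝ v x := by
    intro Z hZ
    have := hv (Z - x) (PointedCone.subset_hull ⟨Z, hZ.trans_eq hgx.symm, rfl⟩)
    rw [inner_sub_right] at this
    linarith
  set l := (inner ℝ v x : ℝ) with hl
  have hl0 : 0 ≤ l := by simpa using h1 0 (by simp)
  have h2 : ∀ Y, inner ℝ v Y ≤ l * gauge C Y := by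
    intro Y
    rcases (gauge_nonneg (s := C) Y).eq_or_lt with h | h
    · rw [← h, mul_zero]
      by_contra! hlt
      -- Directions of gauge 0 can be scaled freely; this factor makes the pairing with v equal to l
      -- + 1, above the maximum l.
      have h3 := h1 (((l + 1) / inner ℝ v Y) • Y) (by
        rw [gauge_smul_of_nonneg' C (by positivity), ← h]; simp)
      rw [real_inner_smul_right, div_mul_cancel₀ _ hlt.ne'] at h3
      linarith
    · have h3 := h1 ((gauge C Y)⁻¹ • Y) (by
        rw [gauge_smul_of_nonneg' C (by positivity), inv_mul_cancel₀ h.ne'])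
      rwa [real_inner_smul_right, inv_mul_le_iff₀ h, mul_comm] at h3
  have hvX : inner ℝ v X = l * gauge C X := by
    rw [hl, hx, real_inner_smul_right]
    field_simp
  rcases hl0.eq_or_lt with h | h
  · obtain ⟨w, hw⟩ := hne
    refine ⟨0, le_rfl, w, hw, ?_⟩
    have := h2 v
    rw [← h, zero_mul, real_inner_self_eq_norm_sq] at this
    rw [zero_smul]
    have h3 := norm_nonneg v
    exact norm_eq_zero.1 (by nlinarith)
  · refine ⟨l, hl0, l⁻¹ • v, mem_subdifferential_gauge.2 ⟨fun Y => ?_, ?_⟩, ?_⟩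
    · rw [real_inner_smul_left, inv_mul_le_iff₀ h]; exact h2 Y
    · rw [real_inner_smul_left, hvX, inv_mul_cancel_left₀ h.ne']
    · rw [smul_inv_smul₀ h.ne']

/-- The choice Z = 0 gives this direction. It supplies the unit vector required by
`integral_infDist_polarCone_le`. -/
theorem neg_normalized_mem_tangentCone (hX : gauge C X ≠ 0) :
    -(‖X‖⁻¹ • X) ∈ tangentCone C X ∩ Metric.sphere 0 1 := by
  have hX0 : X ≠ 0 := by rintro rfl; simp at hX
  have hpos : 0 < gauge C X := lt_of_le_of_ne (gauge_nonneg _) hX.symm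
  refine ⟨?_, by simp [norm_smul, hX0]⟩
  have h1 : -((gauge C X)⁻¹ • X) ∈ tangentCone C X :=
    PointedCone.subset_hull ⟨0, by rw [gauge_zero]; exact gauge_nonneg _, by simp⟩
  have h2 := PointedCone.smul_mem (PointedCone.hull ℝ {D | ∃ Z, gauge C Z ≤ gauge C ((gauge C X)⁻¹ • X) ∧
    D = Z - (gauge C X)⁻¹ • X}) (show 0 ≤ ‖X‖⁻¹ * gauge C X by positivity) h1
  convert! h2 using 1
  rw [smul_neg, smul_smul, mul_assoc, mul_inv_cancel₀ hX, mul_one]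

/-- All points of a set have the same inner product with the projection of `0` onto its affine
hull. -/
theorem inner_euclideanProj_affineSpan {K : Set (EuclideanSpace ℝ (Fin p))} (hne : K.Nonempty)
    {w : EuclideanSpace ℝ (Fin p)} (hw : w ∈ K) :
    inner ℝ w (euclideanProj (affineSpan ℝ K : Set (EuclideanSpace ℝ (Fin p))) 0) =
      ‖euclideanProj (affineSpan ℝ K : Set (EuclideanSpace ℝ (Fin p))) 0‖ ^ 2 := by
  obtain ⟨h1, h2⟩ := euclideanProj_spec (AffineSubspace.closed_of_finiteDimensional (affineSpan ℝ K))
    (hne.mono (subset_affineSpan ℝ K)) 0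
  set w0 := euclideanProj (affineSpan ℝ K : Set (EuclideanSpace ℝ (Fin p))) 0
  have hwA : w ∈ affineSpan ℝ K := subset_affineSpan ℝ K hw
  have h3 : inner ℝ (w - w0) w0 = (0 : ℝ) := by
    have hconv : Convex ℝ (affineSpan ℝ K : Set (EuclideanSpace ℝ (Fin p))) :=
      (affineSpan ℝ K).convex
    have hmin : ‖(0 : EuclideanSpace ℝ (Fin p)) - w0‖
        = ⨅ v : (affineSpan ℝ K : Set (EuclideanSpace ℝ (Fin p))), ‖0 - (v : EuclideanSpace ℝ (Fin p))‖ := by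
      have : Nonempty (affineSpan ℝ K : Set (EuclideanSpace ℝ (Fin p))) := ⟨⟨w0, h1⟩⟩
      refine le_antisymm (le_ciInf fun v => h2 v v.2) ?_
      exact ciInf_le ⟨0, by rintro _ ⟨v, rfl⟩; positivity⟩
        (⟨w0, h1⟩ : (affineSpan ℝ K : Set (EuclideanSpace ℝ (Fin p))))
    have h := (norm_eq_iInf_iff_real_inner_le_zero hconv h1).1 hmin
    have ha := h w hwA
    -- The reflection of w through `w0` stays in the affine span and reverses the inequality.
    have hb := h (AffineMap.lineMap w0 w (-1 : ℝ)) (AffineMap.lineMap_mem _ h1 hwA)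
    rw [AffineMap.lineMap_apply, vsub_eq_sub, vadd_eq_add, add_sub_cancel_right,
      real_inner_smul_right] at hb
    rw [real_inner_comm]
    rw [zero_sub, inner_neg_left] at ha hb
    linarith
  rw [inner_sub_left, real_inner_self_eq_norm_sq] at h3
  linarith

/-- The affine hull lies in the hyperplane ⟨u, X⟩ = ‖X‖_C, which misses 0. -/
theorem euclideanProj_affineSpan_subdifferential_ne_zero (hX : gauge C X ≠ 0)
    (hne : (subdifferential (gauge C) X).Nonempty) :
    euclideanProj (affineSpan ℝ (subdifferential (gauge C) X) :
      Set (EuclideanSpace ℝ (Fin p))) 0 ≠ 0 := by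
  obtain ⟨h1, -⟩ := euclideanProj_spec (AffineSubspace.closed_of_finiteDimensional
    (affineSpan ℝ (subdifferential (gauge C) X))) (hne.mono (subset_affineSpan ℝ _)) 0
  intro h
  rw [h] at h1
  obtain ⟨w, hw⟩ := hne
  have hspan : ∀ u ∈ affineSpan ℝ (subdifferential (gauge C) X), inner ℝ u X = gauge C X := by
    intro u hu
    refine affineSpan_induction hu (fun x hx => (mem_subdifferential_gauge.1 hx).2) ?_
    · intro c x y z hx hy hz
      rw [vsub_eq_sub, vadd_eq_add, inner_add_left, real_inner_smul_left, inner_sub_left, hx, hy, hz]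
      ring
  have := hspan 0 h1
  rw [inner_zero_left] at this
  exact hX this.symm

end subdifferential

/-! ### Comparison of distances and conclusion. -/

/-- The mean distance to the normal cone is at most the Gaussian width of the spherical part of the
tangent cone, up to an additive constant. -/
theorem integral_infDist_polarCone_le {p : ℕ} (T : PointedCone ℝ (EuclideanSpace ℝ (Fin p)))
    {z₀ : EuclideanSpace ℝ (Fin p)}
    (hz₀ : z₀ ∈ (T : Set (EuclideanSpace ℝ (Fin p))) ∩ Metric.sphere 0 1) :
    ∫ g, Metric.infDist g (polarCone (T : Set (EuclideanSpace ℝ (Fin p))))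
      ∂(stdGaussian (EuclideanSpace ℝ (Fin p))) ≤
      gaussianWidth ((T : Set (EuclideanSpace ℝ (Fin p))) ∩ Metric.sphere 0 1) + 1 := by
  have hw := integrable_sSup_inner_stdGaussian _
    (Set.inter_subset_right (s := (T : Set (EuclideanSpace ℝ (Fin p)))) (t := Metric.sphere 0 1))
  have hnorm : ‖innerSL ℝ z₀‖ = 1 := by
    rw [innerSL_apply_norm]; simpa using hz₀.2
  have hsq : ∫ g, (innerSL ℝ z₀ g) ^ 2 ∂(stdGaussian (EuclideanSpace ℝ (Fin p))) = 1 := by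
    rw [integral_sq_strongDual_stdGaussian, hnorm, one_pow]
  have hm : MemLp (fun g => innerSL ℝ z₀ g) 2 (stdGaussian (EuclideanSpace ℝ (Fin p))) :=
    (innerSL ℝ z₀).lipschitz.memLp_two_gaussian _
  have hq : Integrable (fun g => 1 / 2 + 1 / 2 * (innerSL ℝ z₀ g) ^ 2)
      (stdGaussian (EuclideanSpace ℝ (Fin p))) :=
    (integrable_const _).add (hm.integrable_sq.const_mul _)
  have hqi : ∫ g, (1 / 2 + 1 / 2 * (innerSL ℝ z₀ g) ^ 2)
      ∂(stdGaussian (EuclideanSpace ℝ (Fin p))) = 1 := by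
    rw [integral_add (integrable_const _) (hm.integrable_sq.const_mul _), integral_const_mul, hsq]
    simp
    norm_num
  refine le_of_le_of_eq ?_ ((integral_add hw hq).trans (congrArg _ hqi))
  refine integral_mono (integrable_infDist_stdGaussian _) (hw.add hq) fun g => ?_
  refine (infDist_polarCone_le T g).trans ?_
  have h1 : inner ℝ g z₀ ≤ sSup ((fun z => (inner ℝ g z : ℝ)) ''
      ((T : Set (EuclideanSpace ℝ (Fin p))) ∩ Metric.sphere 0 1)) :=
    le_csSup (bddAbove_inner_image Set.inter_subset_right g) ⟨z₀, hz₀, rfl⟩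
  rw [real_inner_comm, ← innerSL_apply_apply ℝ] at h1
  -- With t = ⟨z₀, g⟩ at most the supremum s, -s ≤ -t ≤ (1 + t²)/2, and the right side has mean 1.
  refine max_le ?_ ?_ <;> nlinarith [sq_nonneg (innerSL ℝ z₀ g + 1), sq_nonneg (innerSL ℝ z₀ g)]

/-- The distance to a fixed dilate of a convex set `K` exceeds the distance to the cone spanned by
`K` by at most the change of scale times the norm of a point of `K`. -/
theorem infDist_smul_le {p : ℕ} {K : Set (EuclideanSpace ℝ (Fin p))} (hK : Convex ℝ K)
    {w u g : EuclideanSpace ℝ (Fin p)} (hw : w ∈ K) (hu : u ∈ K) {l l' : ℝ} (hl : 0 ≤ l)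
    (hll : l ≤ l') : Metric.infDist g (l' • K) ≤ ‖g - l • w‖ + (l' - l) * ‖u‖ := by
  have hmem : l • w + (l' - l) • u ∈ l' • K := by
    -- Convexity gives l'K = lK + (l' - l)K.
    have := hK.add_smul hl (sub_nonneg.2 hll)
    rw [add_sub_cancel] at this
    rw [this]
    exact Set.add_mem_add (Set.smul_mem_smul_set hw) (Set.smul_mem_smul_set hu)
  refine (Metric.infDist_le_dist_of_mem hmem).trans ?_
  rw [dist_eq_norm, ← sub_sub]
  refine (norm_sub_le _ _).trans_eq ?_
  rw [norm_smul, Real.norm_of_nonneg (sub_nonneg.2 hll)]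

theorem proposition3 (p : ℕ) (C : Set (EuclideanSpace ℝ (Fin p))) (hC : Convex ℝ C)
    (h0 : (0 : EuclideanSpace ℝ (Fin p)) ∈ interior C)
    (X : EuclideanSpace ℝ (Fin p)) (hX : gauge C X ≠ 0) :
    gaussianDistance C X ≤
      gaussianWidth (tangentCone C X ∩ Metric.sphere 0 1) + 3 * skewness C X + 4 := by
  have hX0 : X ≠ 0 := by rintro rfl; simp at hX
  set γ := stdGaussian (EuclideanSpace ℝ (Fin p)) with hγ
  set K := subdifferential (gauge C) X
  set N := polarCone (tangentCone C X)
  have hne : K.Nonempty := subdifferential_gauge_nonempty hC h0 hX0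
  have hKc : Convex ℝ K := convex_subdifferential _ _
  set w₀ := euclideanProj (affineSpan ℝ K : Set (EuclideanSpace ℝ (Fin p))) 0
  set w₁ := euclideanProj K 0
  have hw₀0 : w₀ ≠ 0 := euclideanProj_affineSpan_subdifferential_ne_zero hX hne
  have hd : 0 < ‖w₀‖ := norm_pos_iff.2 hw₀0
  have hw₁K : w₁ ∈ K := (euclideanProj_spec (isClosed_subdifferential _ _) hne 0).1
  have hκ : skewness C X = ‖w₁‖ / ‖w₀‖ := rfl
  choose P hPN hP1 hP2 using exists_cone_projection (isClosed_polarCone (tangentCone C X))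
    (convex_polarCone _) (zero_mem_polarCone _) (fun c hc x hx => smul_mem_polarCone hc hx)
  -- the scale of the projection onto the normal cone
  set lam : EuclideanSpace ℝ (Fin p) → ℝ := fun g => inner ℝ (P g) w₀ / ‖w₀‖ ^ 2 with hlam
  have hPlam : ∀ g, 0 ≤ lam g ∧ ∃ w ∈ K, P g = lam g • w := by
    intro g
    obtain ⟨l, hl, w, hw, h⟩ := exists_smul_subdifferential_of_mem_polarCone hX hne (hPN g)
    have : lam g = l := by
      simp only [hlam]
      rw [h, real_inner_smul_left, inner_euclideanProj_affineSpan hne hw,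
        mul_div_cancel_right₀ _ (by positivity)]
    rw [this]
    exact ⟨hl, w, hw, h⟩
  set d : NNReal := ‖w₀‖₊⁻¹
  have hdd : (d : ℝ) = ‖w₀‖⁻¹ := by simp [d]
  -- The cone projection is nonexpansive, and pairing with w₀/‖w₀‖² has norm 1/‖w₀‖.
  have hlamLip : LipschitzWith d lam := by
    refine LipschitzWith.of_dist_le_mul fun g g' => ?_
    have h1 : ‖P g - P g'‖ ≤ ‖g - g'‖ := norm_cone_projection_sub_le (hP1 g _ (hPN g')) (hP2 g)
      (hP1 g' _ (hPN g)) (hP2 g')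
    have h2 := abs_real_inner_le_norm (P g - P g') w₀
    simp only [hlam]
    rw [hdd, Real.dist_eq, dist_eq_norm, ← sub_div, ← inner_sub_left, abs_div,
      abs_of_nonneg (by positivity : 0 ≤ ‖w₀‖ ^ 2), div_le_iff₀ (by positivity)]
    refine h2.trans ?_
    have : ‖w₀‖⁻¹ * ‖g - g'‖ * ‖w₀‖ ^ 2 = ‖g - g'‖ * ‖w₀‖ := by field_simp
    rw [this]
    gcongr
  set m := ∫ g, lam g ∂γ with hm
  have hm0 : 0 ≤ m := integral_nonneg fun g => (hPlam g).1
  set l := m + 3 / 2 * ‖w₀‖⁻¹ with hl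
  have hl0 : 0 ≤ l := by positivity
  set G : EuclideanSpace ℝ (Fin p) → ℝ := fun g =>
    Metric.infDist g (l • K) - Metric.infDist g N - ‖w₁‖ * (l - lam g) with hG
  set n₁ : NNReal := ‖w₁‖₊
  have hGLip : LipschitzWith (1 + 1 + n₁ * d) G := by
    refine LipschitzWith.of_dist_le_mul fun g g' => ?_
    have h1 := (Metric.lipschitz_infDist_pt (l • K)).dist_le_mul g g'
    have h2 := (Metric.lipschitz_infDist_pt N).dist_le_mul g g'
    have h3 := hlamLip.dist_le_mul g g'
    simp only [hG]
    rw [Real.dist_eq] at h1 h2 h3 ⊢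
    have h4 := mul_le_mul_of_nonneg_left h3 (norm_nonneg w₁)
    have h5 : ∀ a b c a' b' c' : ℝ, |a - b - ‖w₁‖ * (l - c) - (a' - b' - ‖w₁‖ * (l - c'))| ≤
        |a - a'| + |b - b'| + ‖w₁‖ * |c - c'| := by
      intro a b c a' b' c'
      have : a - b - ‖w₁‖ * (l - c) - (a' - b' - ‖w₁‖ * (l - c'))
        = (a - a') - (b - b') + ‖w₁‖ * (c - c') := by ring
      rw [this]
      refine (abs_add_le _ _).trans ?_
      rw [abs_mul, abs_of_nonneg (norm_nonneg w₁)]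
      gcongr
      exact abs_sub _ _
    refine (h5 _ _ _ _ _ _).trans ?_
    push_cast [n₁] at h1 h2 ⊢
    linarith
  have hlamM : MemLp lam 2 γ := hlamLip.memLp_two_gaussian _
  have hGM : MemLp G 2 γ := hGLip.memLp_two_gaussian _
  have hGle : ∫ g, G g ∂γ ≤ 3 / 2 * ((1 + 1 + n₁ * d : NNReal) : ℝ) := by
    refine integral_le_of_nonpos_of_le_mean_add hlamM hGM (s := 3 / 2 * ‖w₀‖⁻¹) (by positivity)
      (by positivity) hlamLip.integral_sq_sub_integral_stdGaussian_le'
      hGLip.integral_sq_sub_integral_stdGaussian_le' fun g hg => ?_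
    obtain ⟨hg0, w, hw, hPw⟩ := hPlam g
    have h1 := infDist_smul_le hKc hw hw₁K hg0 hg (g := g)
    rw [← hPw, ← infDist_eq_norm_sub_cone_projection (hPN g) (hP1 g) (hP2 g)] at h1
    change Metric.infDist g (l • K) ≤ Metric.infDist g N + (l - lam g) * ‖w₁‖ at h1
    simp only [hG]
    linarith
  have hD : gaussianDistance C X ≤ ∫ g, Metric.infDist g (l • K) ∂γ :=
    csInf_le ⟨0, by rintro _ ⟨t, -, rfl⟩; exact integral_nonneg fun g => Metric.infDist_nonneg⟩
      ⟨l, hl0, rfl⟩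
  have hDI := integrable_infDist_stdGaussian (l • K)
  have hNI := integrable_infDist_stdGaussian N
  have hlamI : Integrable lam γ := hlamM.integrable (by norm_num)
  have hGI : ∫ g, G g ∂γ = ∫ g, Metric.infDist g (l • K) ∂γ - ∫ g, Metric.infDist g N ∂γ
      - ‖w₁‖ * (l - m) := by
    simp only [hG]
    have h1 : Integrable (fun g => Metric.infDist g (l • K) - Metric.infDist g N) γ := hDI.sub hNI
    have h2 : Integrable (fun g => ‖w₁‖ * (l - lam g)) γ :=
      ((integrable_const l).sub hlamI).const_mul _
    rw [integral_sub h1 h2,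
      integral_sub hDI hNI, integral_const_mul, integral_sub (integrable_const _) hlamI]
    simp [hm, hγ]
  have hNle : ∫ g, Metric.infDist g N ∂γ ≤
      gaussianWidth (tangentCone C X ∩ Metric.sphere 0 1) + 1 :=
    integral_infDist_polarCone_le _ (neg_normalized_mem_tangentCone hX)
  have hlm : ‖w₁‖ * (l - m) = 3 / 2 * (‖w₁‖ / ‖w₀‖) := by rw [hl]; ring
  have hcoe : ((1 + 1 + n₁ * d : NNReal) : ℝ) = 2 + ‖w₁‖ / ‖w₀‖ := by
    push_cast [n₁]
    rw [hdd, div_eq_mul_inv]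
    ring
  rw [hκ]
  rw [hcoe] at hGle
  -- Total beyond the width: 1 from the polar cone, (3/2)κ from l - m, and (3/2)(2 + κ) from the
  -- mean of `G`.
  linarith
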